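/- Consider circuits in the Thompson VLSI grid model: on a planar grid of squares of width $\lambda_{\mathrm w}>0$, each square is empty or contains a computational node (to which at most four wires are attached, at most one at each side of its square), a wire (connecting one side of the square to another side), or a wire crossing (two wires, one connecting north to south and one connecting east to west), and only finitely many squares are occupied. The area $A$ of the circuit is $\lambda_{\mathrm w}^2$ times the number of occupied (non-empty) squares. The graph of the circuit is the multigraph whose vertices are the computational nodes and whose edges are the wires leading from node to node. A multigraph $H$ contains a multigraph $G$ if some subgraph of $H$ is, up to isomorphism, a subdivision of $G$, i.e. obtained from $G$ by successively replacing an edge $v_1v_2$ by a new vertex $v'$ and two new edges $v_1v'$ and $v'v_2$. Theorem. Let $G=(V,E)$ be a multigraph (with at least one vertex) that has no loops. If the graph of a circuit with wire width $\lambda_{\mathrm w}$ contains $G$, then the area $A$ of the circuit satisfies \[ A\;\ge\;\frac{\lambda_{\mathrm w}^{2}\,(\sqrt2-1)^{2}}{4}\,\frac{|E|^{2}}{|V|}. \] -/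

import Mathlib

open scoped Graph

namespace VLSI

universe u v w z

/-! ### Multigraphs: isomorphism, subdivision, containment -/

/-- Two multigraphs (possibly with different types of labels) are isomorphic. -/
def Isomorphic {α : Type u} {β : Type v} {γ : Type w} {δ : Type z}
    (G : Graph α β) (H : Graph γ δ) : Prop :=
  ∃ (f : V(G) ≃ V(H)) (g : E(G) ≃ E(H)), ∀ (e : E(G)) (x y : V(G)),
    G.IsLink e x y ↔ H.IsLink (g e) (f x) (f y)

/-- `G'` arises from `G` by subdividing one edge: an edge `e` of `G` with ends `x` and `y` is
replaced by a new vertex `m` and two new edges `e₁` (joining `x` and `m`) and `e₂`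
(joining `m` and `y`). A new edge may reuse the label `e` of the edge that disappears. -/
def SubdividesEdge {γ : Type w} {δ : Type z} (G G' : Graph γ δ) : Prop :=
  ∃ (e e₁ e₂ : δ) (x y m : γ),
    G.IsLink e x y ∧ m ∉ V(G) ∧ e₁ ≠ e₂ ∧ e₁ ∉ E(G) \ {e} ∧ e₂ ∉ E(G) \ {e} ∧
    V(G') = insert m V(G) ∧
    ∀ (f : δ) (a b : γ), G'.IsLink f a b ↔
      (f ≠ e ∧ G.IsLink f a b) ∨ (f = e₁ ∧ s(a, b) = s(x, m)) ∨ (f = e₂ ∧ s(a, b) = s(m, y))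

/-- `K` is (up to isomorphism) a subdivision of `G`, that is, it is obtained from a copy of `G`
by successive subdivisions of edges. Since subdividing never removes vertices and may reuse the
label of the subdivided edge, the copy and all intermediate graphs can be taken over
the label types of `K`. -/
def IsSubdivisionOf {α : Type u} {β : Type v} {γ : Type w} {δ : Type z}
    (K : Graph γ δ) (G : Graph α β) : Prop :=
  ∃ G₀ : Graph γ δ, Isomorphic G G₀ ∧ Relation.ReflTransGen SubdividesEdge G₀ K

/-- `H` contains `G`: some subgraph of `H` is a subdivision of `G`. -/
def Contains {α : Type u} {β : Type v} {γ : Type w} {δ : Type z}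
    (H : Graph γ δ) (G : Graph α β) : Prop :=
  ∃ K : Graph γ δ, K ≤ H ∧ IsSubdivisionOf K G

/-! ### The grid -/

/-- A square of the planar grid. -/
abbrev Square : Type := ℤ × ℤ

/-- The four sides of a grid square. -/
inductive Side : Type
  | north
  | east
  | south
  | west

/-- The opposite side of a square. -/
def Side.opposite : Side → Side
  | north => south
  | east => west
  | south => north
  | west => east

/-- The square that shares the side `s` of the square `p`. -/
def Side.neighbor (p : Square) : Side → Square
  | north => (p.1, p.2 + 1)
  | east => (p.1 + 1, p.2)
  | south => (p.1, p.2 - 1)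
  | west => (p.1 - 1, p.2)

/-- The content of a grid square: nothing, a computational node (with the set of those of its
four sides at which it accepts a wire, hence at most four wires), a wire connecting one side of
the square to another side, or a wire crossing (one wire connecting north and south, another
one connecting east and west). -/
inductive Cell : Type
  | empty
  | node (ports : Set Side)
  | wire (s t : Side) (hst : s ≠ t)
  | crossing

/-- A wire inside the square connects the sides `a` and `b`. -/
def Cell.Joins : Cell → Side → Side → Prop
  | .empty, _, _ => False
  | .node _, _, _ => False
  | .wire s t _, a, b => s(a, b) = s(s, t)
  | .crossing, a, b => b = a.opposite

/-- A side of a square; it is used for the places where wires are attached to nodes, and also to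
record the side through which a wire leaves a square. -/
abbrev Port : Type := Square × Side

/-- The same side, seen from the neighboring square. -/
def Port.flip (h : Port) : Port := (h.2.neighbor h.1, h.2.opposite)

/-! ### Circuits -/

/-- A circuit: nodes, wires and wire crossings laid out on the grid, finitely many squares being
occupied. Input and output nodes are nodes; which nodes they are, and which functions the nodes
compute, affects neither the area nor the graph of the circuit. -/
structure Circuit : Type where
  /-- The wire width, which is the width of a grid square. -/
  wireWidth : ℝ
  wireWidth_pos : 0 < wireWidth
  /-- The content of each square. -/
  cell : Square → Cell
  finite_occupied : {p | cell p ≠ Cell.empty}.Finite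

namespace Circuit

variable (C : Circuit)

/-- The number of occupied grid squares. -/
noncomputable def normalizedArea : ℕ := {p | C.cell p ≠ Cell.empty}.ncard

/-- The area: each occupied grid square counts with the square of the wire width. -/
noncomputable def area : ℝ := C.wireWidth ^ 2 * (C.normalizedArea : ℝ)

/-- The square `p` contains a computational node. -/
def IsNode (p : Square) : Prop := ∃ P, C.cell p = Cell.node P

/-- `a` is a side of a node at which that node accepts a wire. -/
def IsPort (a : Port) : Prop := ∃ P, C.cell a.1 = Cell.node P ∧ a.2 ∈ P

/-- A wire that leaves the square `h.1` through its side `h.2` next leaves the square `k.1`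
(adjacent to `h.1` across that side) through its side `k.2`. -/
def Step (h k : Port) : Prop :=
  k.1 = h.2.neighbor h.1 ∧ (C.cell k.1).Joins h.2.opposite k.2

/-- The ports `a` and `b` are the two ends of a wire: following the wire out of `a` through
squares with wires or wire crossings, one arrives at `b`. -/
def WireBetween (a b : Port) : Prop :=
  C.IsPort a ∧ C.IsPort b ∧ Relation.ReflTransGen C.Step a b.flip

end Circuit

theorem Side.opposite_opposite (s : Side) : s.opposite.opposite = s := by
  cases s <;> rfl

theorem Port.flip_flip (h : Port) : h.flip.flip = h := by
  obtain ⟨⟨x, y⟩, s⟩ := h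
  cases s <;> simp [Port.flip, Side.neighbor, Side.opposite]

theorem Cell.Joins.symm {c : Cell} {a b : Side} (h : c.Joins a b) : c.Joins b a := by
  cases c with
  | empty => exact h
  | node P => exact h
  | wire s t hst => exact Sym2.eq_swap.trans h
  | crossing =>
    have h' : b = a.opposite := h
    change a = b.opposite
    rw [h', Side.opposite_opposite]

theorem Circuit.Step.flip {C : Circuit} {h k : Port} (hk : C.Step h k) :
    C.Step k.flip h.flip := by
  obtain ⟨h1, h2⟩ := hk
  have h3 := congrArg Prod.fst (Port.flip_flip k)
  refine ⟨?_, ?_⟩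
  · change h.2.neighbor h.1 = k.flip.2.neighbor k.flip.1
    rw [← h1]
    exact h3.symm
  · change (C.cell (h.2.neighbor h.1)).Joins k.2.opposite.opposite h.2.opposite
    rw [Side.opposite_opposite, ← h1]
    exact h2.symm

theorem Circuit.WireBetween.symm {C : Circuit} {a b : Port} (h : C.WireBetween a b) :
    C.WireBetween b a := by
  obtain ⟨ha, hb, hab⟩ := h
  refine ⟨hb, ha, ?_⟩
  have key : ∀ c : Port, Relation.ReflTransGen C.Step a c →
      Relation.ReflTransGen C.Step c.flip a.flip := by
    intro c hc
    induction hc with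
    | refl => exact Relation.ReflTransGen.refl
    | tail _ hstep ih => exact Relation.ReflTransGen.head hstep.flip ih
  have h1 := key _ hab
  rwa [Port.flip_flip] at h1

/-- The multigraph of a circuit: its vertices are the squares that contain a node, and its edges
are the wires, each given by the unordered pair of ports at its two ends. -/
def Circuit.graph (C : Circuit) : Graph Square (Sym2 Port) where
  vertexSet := {p | C.IsNode p}
  IsLink e p q := ∃ s t : Side, e = s((p, s), (q, t)) ∧ C.WireBetween (p, s) (q, t)
  isLink_symm := by
    refine fun e _ => ⟨?_⟩
    rintro p q ⟨s, t, rfl, hw⟩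
    exact ⟨t, s, Sym2.eq_swap, hw.symm⟩
  eq_or_eq_of_isLink_of_isLink := by
    rintro e p q p' q' ⟨s, t, rfl, -⟩ ⟨s', t', he, -⟩
    rcases Sym2.eq_iff.1 he with ⟨h1, -⟩ | ⟨h1, -⟩
    · exact Or.inl (congrArg Prod.fst h1)
    · exact Or.inr (congrArg Prod.fst h1)
  left_mem_of_isLink := by
    rintro e p q ⟨s, t, -, ⟨P, hP, -⟩, -⟩
    exact ⟨P, hP⟩

end VLSI

namespace VLSI

/-! The constant is small enough for a degree count; no layout or bisection argument is needed. A
node has four sides and each side starts at most one wire, so at most four edges of the circuit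
graph meet any vertex. Subdivision never lowers this count, so it passes to `G`
(`Contains.encard_le`) and gives |E| ≤ 4|V|, hence |E|²/|V| ≤ 16|V|. As (√2 - 1)² ≤ 1/4, the claimed
bound is at most λ²|V|, and the vertices of `G` inject into the occupied squares. -/

/-- A bound `k` on the number of edges at each vertex bounds the number of edges. -/
theorem ncard_edgeSet_le {α : Type*} {β : Type*} {G : Graph α β} {k : ℕ}
    (hfin : V(G).Finite) (hdeg : ∀ v, (G.incidenceSet v).encard ≤ k) :
    E(G).ncard ≤ k * V(G).ncard := by
  have := hfin.fintype
  have hsub : E(G) ⊆ ⋃ v : V(G), G.incidenceSet v := by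
    intro e he
    obtain ⟨x, y, hxy⟩ := G.exists_isLink_of_mem_edgeSet he
    exact Set.mem_iUnion.2 ⟨⟨x, hxy.left_mem⟩, y, hxy⟩
  have hcard : E(G).encard ≤ (k * V(G).ncard : ℕ) := calc
    E(G).encard ≤ (⋃ v : V(G), G.incidenceSet v).encard := Set.encard_le_encard hsub
    _ ≤ ∑ v : V(G), (G.incidenceSet v).encard := Set.encard_iUnion_le_of_fintype _
    _ ≤ ∑ _v : V(G), (k : ℕ∞) := Finset.sum_le_sum fun v _ => hdeg v
    _ = (k * V(G).ncard : ℕ) := by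
      rw [Finset.sum_const, Finset.card_univ, ← Nat.card_eq_fintype_card, Nat.card_coe_set_eq,
        nsmul_eq_mul, Nat.cast_mul, mul_comm]
  have hE : E(G).Finite := Set.finite_of_encard_le_coe hcard
  rw [← hE.cast_ncard_eq] at hcard
  exact_mod_cast hcard

/-- Isomorphisms do not change the bound on the number of edges at a vertex. -/
theorem Isomorphic.encard_incidenceSet_le {α : Type*} {β : Type*} {γ : Type*} {δ : Type*}
    {G : Graph α β} {H : Graph γ δ} (h : Isomorphic G H) {k : ℕ∞}
    (hdeg : ∀ v, (H.incidenceSet v).encard ≤ k) (v : α) :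
    (G.incidenceSet v).encard ≤ k := by
  obtain ⟨f, g, hfg⟩ := h
  by_cases hv : v ∈ V(G)
  · have himage : G.incidenceSet v = Subtype.val '' {e : E(G) | G.Inc e v} := by
      ext e
      constructor
      · exact fun he => ⟨⟨e, he.edge_mem⟩, he, rfl⟩
      · rintro ⟨e, he, rfl⟩
        exact he
    rw [himage, Subtype.val_injective.injOn.encard_image]
    refine (Set.encard_le_encard_of_injOn (f := fun e => (g e : δ)) ?_
      (Subtype.val_injective.comp g.injective).injOn).trans (hdeg (f ⟨v, hv⟩))
    rintro e ⟨y, hy⟩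
    exact ⟨f ⟨y, hy.right_mem⟩, (hfg e ⟨v, hv⟩ ⟨y, hy.right_mem⟩).1 hy⟩
  · have hempty : G.incidenceSet v = ∅ :=
      Set.eq_empty_of_forall_notMem fun e he => hv he.vertex_mem
    simp [hempty]

/-- Subdividing an edge does not remove vertices. -/
theorem SubdividesEdge.vertexSet_subset {γ : Type*} {δ : Type*} {G G' : Graph γ δ}
    (h : SubdividesEdge G G') : V(G) ⊆ V(G') := by
  obtain ⟨e, e₁, e₂, x, y, m, -, -, -, -, -, hV, -⟩ := h
  rw [hV]
  exact Set.subset_insert _ _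

/-- Subdividing an edge does not decrease the number of edges at any vertex. -/
theorem SubdividesEdge.encard_incidenceSet_le {γ : Type*} {δ : Type*} {G G' : Graph γ δ}
    (h : SubdividesEdge G G') (v : γ) :
    (G.incidenceSet v).encard ≤ (G'.incidenceSet v).encard := by
  classical
  obtain ⟨e, e₁, e₂, x, y, m, hxy, -, -, he₁, he₂, -, hlink⟩ := h
  -- At `v` the lost edge `e` is replaced by whichever half touches `v`. That half is not another
  -- edge of `G`, which keeps the substitution injective.
  obtain ⟨e', he', hinc⟩ : ∃ e', e' ∉ E(G) \ {e} ∧ (G.Inc e v → G'.Inc e' v) := by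
    by_cases hvx : v = x
    · exact ⟨e₁, he₁, fun _ => ⟨m, (hlink _ _ _).2 (Or.inr (Or.inl ⟨rfl, by rw [hvx]⟩))⟩⟩
    · refine ⟨e₂, he₂, fun hv => ⟨m, (hlink _ _ _).2 (Or.inr (Or.inr ⟨rfl, ?_⟩))⟩⟩
      rw [hv.eq_of_isLink_of_ne_left hxy hvx]
      exact Sym2.eq_swap
  refine Set.encard_le_encard_of_injOn (f := fun f => if f = e then e' else f) ?_ ?_
  · intro f hf
    by_cases hfe : f = e
    · subst hfe
      simpa using hinc hf
    · obtain ⟨z, hz⟩ := hf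
      simpa [hfe] using ⟨z, (hlink _ _ _).2 (Or.inl ⟨hfe, hz⟩)⟩
  · intro f hf f' hf' heq
    by_cases hfe : f = e <;> by_cases hfe' : f' = e
    · rw [hfe, hfe']
    · simp only [hfe, hfe', if_true, if_false] at heq
      exact absurd (heq ▸ ⟨hf'.edge_mem, hfe'⟩) he'
    · simp only [hfe, hfe', if_true, if_false] at heq
      exact absurd (heq ▸ ⟨hf.edge_mem, hfe⟩) he'
    · simpa [hfe, hfe'] using heq

/-- A graph contained in a finite graph with at most `k` edges at each vertex has no more vertices
than that graph, and at most `k` edges at each vertex. -/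
theorem Contains.encard_le {α : Type*} {β : Type*} {γ : Type*} {δ : Type*}
    {H : Graph γ δ} {G : Graph α β} (h : Contains H G) {k : ℕ∞}
    (hdeg : ∀ v, (H.incidenceSet v).encard ≤ k) :
    V(G).encard ≤ V(H).encard ∧ ∀ v, (G.incidenceSet v).encard ≤ k := by
  obtain ⟨K, hKH, G₀, hiso, hsub⟩ := h
  have hK : ∀ v, (K.incidenceSet v).encard ≤ k := fun v =>
    (Set.encard_le_encard (fun _ ⟨y, hy⟩ => ⟨y, hy.mono hKH⟩ :
      K.incidenceSet v ⊆ H.incidenceSet v)).trans (hdeg v)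
  have hG₀ : V(G₀) ⊆ V(K) ∧ ∀ v, (G₀.incidenceSet v).encard ≤ k := by
    clear hiso
    -- The bound is known at the final graph `K`, so the subdivisions are undone one by one.
    induction hsub using Relation.ReflTransGen.head_induction_on with
    | refl => exact ⟨subset_rfl, hK⟩
    | head hstep _ ih =>
      exact ⟨hstep.vertexSet_subset.trans ih.1,
        fun v => (hstep.encard_incidenceSet_le v).trans (ih.2 v)⟩
  refine ⟨?_, hiso.encard_incidenceSet_le hG₀.2⟩
  obtain ⟨f, -⟩ := hiso
  calc V(G).encard = V(G₀).encard := ENat.card_congr f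
    _ ≤ V(H).encard := Set.encard_le_encard (hG₀.1.trans hKH.vertexSet_mono)

theorem Cell.Joins.right_unique {c : Cell} {a b b' : Side} (h : c.Joins a b)
    (h' : c.Joins a b') : b = b' := by
  cases c with
  | empty => exact h.elim
  | node P => exact h.elim
  | wire s t hst =>
    have heq : s(a, b) = s(a, b') := Eq.trans h (Eq.symm h')
    exact Sym2.congr_right.1 heq
  | crossing => exact Eq.trans h (Eq.symm h')

namespace Circuit

variable {C : Circuit}

/-- Tracing a wire is deterministic: the side of entry determines the side of exit. -/
theorem rightUnique_step (C : Circuit) : Relator.RightUnique C.Step := by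
  intro h k k' hk hk'
  obtain ⟨p, s⟩ := k
  obtain ⟨p', s'⟩ := k'
  obtain ⟨hp, hs⟩ := hk
  obtain ⟨hp', hs'⟩ := hk'
  obtain rfl : p = p' := hp.trans hp'.symm
  exact congrArg (Prod.mk p) (hs.right_unique hs')

/-- A wire ends where it reaches a port. -/
theorem IsPort.not_step_flip {b : Port} (hb : C.IsPort b) (k : Port) : ¬ C.Step b.flip k := by
  rintro ⟨h1, h2⟩
  obtain ⟨P, hP, -⟩ := hb
  have hk : k.1 = b.1 := h1.trans (congrArg Prod.fst (Port.flip_flip b))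
  rw [hk, hP] at h2
  exact h2

/-- At most one wire starts at a port. -/
theorem WireBetween.right_unique {a b b' : Port} (h : C.WireBetween a b)
    (h' : C.WireBetween a b') : b = b' := by
  have hend : ∀ {c : Port}, C.IsPort c → ∀ {d}, Relation.ReflTransGen C.Step c.flip d →
      c.flip = d := by
    intro c hc d hd
    rcases hd.cases_head with heq | ⟨k, hk, -⟩
    · exact heq
    · exact absurd hk (hc.not_step_flip k)
  have hflip : b.flip = b'.flip := by
    -- Two deterministic traces from one start are comparable, and neither can continue past a port.
    rcases Relation.ReflTransGen.total_of_right_unique C.rightUnique_step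
      h.2.2 h'.2.2 with hbb | hbb
    · exact hend h.2.1 hbb
    · exact (hend h'.2.1 hbb).symm
  rw [← Port.flip_flip b, hflip, Port.flip_flip]

/-- At most four wires are attached to a node. -/
theorem encard_incidenceSet_graph_le (C : Circuit) (p : Square) :
    (C.graph.incidenceSet p).encard ≤ 4 := by
  -- Each incident edge gets a side of `p` where it is attached; `north` is a dummy value elsewhere.
  have hex : ∀ e : Sym2 Port, ∃ s : Side, e ∈ C.graph.incidenceSet p →
      ∃ b, e = s((p, s), b) ∧ C.WireBetween (p, s) b := by
    intro e
    by_cases he : e ∈ C.graph.incidenceSet p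
    · obtain ⟨q, s, t, rfl, hw⟩ := he
      exact ⟨s, fun _ => ⟨(q, t), rfl, hw⟩⟩
    · exact ⟨Side.north, fun h => absurd h he⟩
  choose side hside using hex
  have hinj : Set.InjOn side (C.graph.incidenceSet p) := by
    intro e he e' he' heq
    obtain ⟨b, hb, hw⟩ := hside e he
    obtain ⟨b', hb', hw'⟩ := hside e' he'
    rw [← heq] at hb' hw'
    rw [hb, hb', hw.right_unique hw']
  have huniv : (Set.univ : Set Side) ⊆
      (↑({0, 1, 2, 3} : Finset ℕ) : Set ℕ).image
        (fun n => [Side.north, Side.east, Side.south, Side.west].getD n Side.north) := by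
    rintro (_ | _ | _ | _) - <;> simp
  calc (C.graph.incidenceSet p).encard ≤ (Set.univ : Set Side).encard :=
        Set.encard_le_encard_of_injOn (Set.mapsTo_univ _ _) hinj
    _ ≤ _ := Set.encard_le_encard huniv
    _ ≤ _ := Set.encard_image_le _ _
    _ = 4 := by rw [Set.encard_coe_eq_coe_finsetCard]; rfl

/-- Each node occupies a square. -/
theorem vertexSet_graph_subset (C : Circuit) : V(C.graph) ⊆ {p | C.cell p ≠ Cell.empty} := by
  rintro p ⟨P, hP⟩
  simp [hP]

end Circuit

end VLSI

theorem theorem2 (C : VLSI.Circuit) {α : Type*} {β : Type*} (G : Graph α β)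
    (hloop : G.Loopless) (hG : VLSI.Contains C.graph G) :
    C.area ≥ C.wireWidth ^ 2 * (Real.sqrt 2 - 1) ^ 2 / 4 *
      ((G.edgeSet.ncard : ℝ) ^ 2 / (G.vertexSet.ncard : ℝ)) := by
  obtain ⟨hV, hdeg⟩ := hG.encard_le C.encard_incidenceSet_graph_le
  replace hV := hV.trans (Set.encard_le_encard C.vertexSet_graph_subset)
  rw [← C.finite_occupied.cast_ncard_eq] at hV
  have hfin : V(G).Finite := Set.finite_of_encard_le_coe hV
  rw [← hfin.cast_ncard_eq] at hV
  have hVA : (V(G).ncard : ℝ) ≤ C.normalizedArea := by exact_mod_cast hV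
  have hE : (E(G).ncard : ℝ) ≤ 4 * V(G).ncard := by
    exact_mod_cast VLSI.ncard_edgeSet_le (k := 4) hfin hdeg
  -- This includes |V| = 0, where the quotient is 0 by convention.
  have hratio : (E(G).ncard : ℝ) ^ 2 / V(G).ncard ≤ 16 * V(G).ncard :=
    div_le_of_le_mul₀ (by positivity) (by positivity)
      (by nlinarith [Nat.cast_nonneg (α := ℝ) E(G).ncard])
  have hsqrt : (Real.sqrt 2 - 1) ^ 2 ≤ 1 / 4 := by
    have h1 : 1 ≤ Real.sqrt 2 := Real.one_le_sqrt.2 (by norm_num)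
    have h2 : Real.sqrt 2 ≤ 3 / 2 := Real.sqrt_le_iff.2 (by norm_num)
    nlinarith
  calc C.wireWidth ^ 2 * (Real.sqrt 2 - 1) ^ 2 / 4 * ((E(G).ncard : ℝ) ^ 2 / V(G).ncard)
      = C.wireWidth ^ 2 * ((Real.sqrt 2 - 1) ^ 2 * ((E(G).ncard : ℝ) ^ 2 / V(G).ncard) / 4) := by
        ring
    -- The constants cancel exactly: 1/4 · 16 / 4 = 1.
    _ ≤ C.wireWidth ^ 2 * (1 / 4 * (16 * V(G).ncard) / 4) := by gcongr
    _ = C.wireWidth ^ 2 * V(G).ncard := by ring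
    _ ≤ C.wireWidth ^ 2 * C.normalizedArea := by gcongr
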